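/- Let $\alpha,\beta$ be positive integers. A metallic structure (with parameters $\alpha,\beta$) on a smooth manifold $N$ is a smooth $(1,1)$-tensor field $A$ on $N$ with $A^2-\alpha A-\beta I=0$. Let $M$ be a finite-dimensional smooth manifold with a metallic structure $\Psi$ (with parameters $\alpha,\beta$) and a smooth affine connection $\nabla$. For a smooth vector field $X$ on $M$ let $X^V$ and $X^H=X^C-\nabla_\gamma X$ be its vertical and horizontal lifts to the tangent bundle $TM$; in the coordinates $(x^h,y^h)$ of $TM$ induced by coordinates $(x^h)$ of $M$, $$X^V=X^h\frac{\partial}{\partial y^h},\qquad X^C=X^h\frac{\partial}{\partial x^h}+y^i\,\frac{\partial X^h}{\partial x^i}\,\frac{\partial}{\partial y^h},\qquad \nabla_\gamma X=y^l\,(\nabla_l X^h)\,\frac{\partial}{\partial y^h}.$$ **Theorem 5.2.** There is exactly one $(1,1)$-tensor field $\tilde J$ on $TM$ such that, for every smooth vector field $X$ on $M$, $$\tilde J X^H=\tfrac12\bigl(\alpha X^H+\sqrt{\alpha^2+4\beta}\,X^V\bigr),\qquad \tilde J X^V=\tfrac12\bigl(\alpha X^V+\sqrt{\alpha^2+4\beta}\,X^H\bigr),$$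 and $\tilde J$ is a metallic structure (with parameters $\alpha,\beta$) on $TM$: it is smooth and $\tilde J^2-\alpha\tilde J-\beta I=0$. -/

import Mathlib

open Bundle Manifold
open scoped ContDiff

noncomputable section

/-- A (not necessarily smooth) field of endomorphisms of the tangent spaces of `M`, i.e. a rough
tensor field of type (1,1). -/
abbrev EndField {E : Type*} [NormedAddCommGroup E] [NormedSpace ℝ E] {H : Type*}
    [TopologicalSpace H] (I : ModelWithCorners ℝ E H) (M : Type*) [TopologicalSpace M]
    [ChartedSpace H M] :=
  Π x : M, TangentSpace I x →L[ℝ] TangentSpace I x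

/-- Smoothness of a field of endomorphisms, as a section of the bundle `Hom(TM, TM)`. -/
def EndField.IsSmooth {E : Type*} [NormedAddCommGroup E] [NormedSpace ℝ E] {H : Type*}
    [TopologicalSpace H] {I : ModelWithCorners ℝ E H} {M : Type*} [TopologicalSpace M]
    [ChartedSpace H M] [IsManifold I 1 M] (A : EndField I M) : Prop :=
  ContMDiff I (I.prod 𝓘(ℝ, E →L[ℝ] E)) ∞
    (fun x : M ↦ (TotalSpace.mk' (E →L[ℝ] E) x (A x) :
      TotalSpace (E →L[ℝ] E) (fun y : M ↦ TangentSpace I y →L[ℝ] TangentSpace I y)))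

/-- A metallic structure with parameters `α`, `β`: a smooth tensor field `A` of type (1,1) with
`A² - α A - β I = 0`. -/
structure IsMetallicStructure {E : Type*} [NormedAddCommGroup E] [NormedSpace ℝ E] {H : Type*}
    [TopologicalSpace H] {I : ModelWithCorners ℝ E H} {M : Type*} [TopologicalSpace M]
    [ChartedSpace H M] [IsManifold I 1 M] (α β : ℕ) (A : EndField I M) : Prop where
  smooth : A.IsSmooth
  equation : ∀ x : M, (A x).comp (A x) - (α : ℝ) • A x
    - (β : ℝ) • ContinuousLinearMap.id ℝ (TangentSpace I x) = 0

section Lifts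

variable {E : Type*} [NormedAddCommGroup E] [NormedSpace ℝ E]
  {M : Type*} [TopologicalSpace M] [ChartedSpace E M] [IsManifold 𝓘(ℝ, E) 1 M]

/-- The vertical lift to `T_u(TM)` of a tangent vector `w ∈ T_p M`, `p = π(u)`: the image of `w`
under the derivative at `u` of the inclusion of the fibre `T_p M` into `TM`. -/
def vectorVerticalLift (u : TangentBundle 𝓘(ℝ, E) M) (w : TangentSpace 𝓘(ℝ, E) u.1) :
    TangentSpace 𝓘(ℝ, E).tangent u :=
  mfderiv 𝓘(ℝ, E) 𝓘(ℝ, E).tangent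
    (fun v : E ↦ (⟨u.1, v⟩ : TangentBundle 𝓘(ℝ, E) M)) u.2 w

/-- The vertical lift `X^V` of a vector field `X` on `M`. -/
def verticalLift (X : Π p : M, TangentSpace 𝓘(ℝ, E) p) (u : TangentBundle 𝓘(ℝ, E) M) :
    TangentSpace 𝓘(ℝ, E).tangent u :=
  vectorVerticalLift u (X u.1)

/-- The components, with respect to the preferred chart around `p`, of a vector field `X`
on `M`, as an `E`-valued function (of interest on the domain of that chart). -/
def localComponents (p : M) (X : Π q : M, TangentSpace 𝓘(ℝ, E) q) (q : M) : E :=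
  (trivializationAt E (TangentSpace 𝓘(ℝ, E)) p (⟨q, X q⟩ : TangentBundle 𝓘(ℝ, E) M)).2

/-- The complete lift `X^C` of a vector field `X` on `M`, given by its local expression
`X^C = X^h ∂/∂x^h + (y^i ∂_i X^h) ∂/∂y^h` in induced coordinates `(x^h, y^h)`.
At `u ∈ T_p M`, Mathlib's identification of `T_u(TM)` with `E × E` is the one given by the
coordinates `(x^h, y^h)` induced by the preferred chart around `p`, so this chart is used. -/
def completeLift (X : Π p : M, TangentSpace 𝓘(ℝ, E) p) (u : TangentBundle 𝓘(ℝ, E) M) :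
    TangentSpace 𝓘(ℝ, E).tangent u :=
  ((X u.1 : E), (mfderiv 𝓘(ℝ, E) 𝓘(ℝ, E) (localComponents u.1 X) u.1 u.2 : E))

/-- The horizontal lift `X^H = X^C - ∇_γ X` of a vector field `X` on `M` with respect to an affine
connection `∇`, where `∇_γ X` is the vertical vector field on `TM` with local expression
`(y^l ∇_l X^h) ∂/∂y^h`, i.e. with value at `u` the vertical lift of `∇_u X`
(`nabla X p u` is Mathlib's notation for `∇_u X`). -/
def horizontalLift (nabla : CovariantDerivative 𝓘(ℝ, E) E (TangentSpace 𝓘(ℝ, E) : M → Type _))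
    (X : Π p : M, TangentSpace 𝓘(ℝ, E) p) (u : TangentBundle 𝓘(ℝ, E) M) :
    TangentSpace 𝓘(ℝ, E).tangent u :=
  completeLift X u - vectorVerticalLift u (nabla X u.1 u.2)

/-- The rough (1,1)-tensor field `J` on `TM` satisfies, for all smooth vector fields `X` on `M`,
`J X^H = (α X^H + √(α² + 4β) X^V) / 2` and `J X^V = (α X^V + √(α² + 4β) X^H) / 2`. -/
structure IsMetallicHVTensor (α β : ℕ)
    (nabla : CovariantDerivative 𝓘(ℝ, E) E (TangentSpace 𝓘(ℝ, E) : M → Type _))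
    (J : EndField 𝓘(ℝ, E).tangent (TangentBundle 𝓘(ℝ, E) M)) : Prop where
  map_horizontal : ∀ X : Π p : M, TangentSpace 𝓘(ℝ, E) p,
    ContMDiff 𝓘(ℝ, E) 𝓘(ℝ, E).tangent ∞ (fun p ↦ (⟨p, X p⟩ : TangentBundle 𝓘(ℝ, E) M)) →
    ∀ u : TangentBundle 𝓘(ℝ, E) M,
      J u (horizontalLift nabla X u) = (1 / 2 : ℝ) •
        ((α : ℝ) • horizontalLift nabla X u
          + √((α : ℝ) ^ 2 + 4 * (β : ℝ)) • verticalLift X u)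
  map_vertical : ∀ X : Π p : M, TangentSpace 𝓘(ℝ, E) p,
    ContMDiff 𝓘(ℝ, E) 𝓘(ℝ, E).tangent ∞ (fun p ↦ (⟨p, X p⟩ : TangentBundle 𝓘(ℝ, E) M)) →
    ∀ u : TangentBundle 𝓘(ℝ, E) M,
      J u (verticalLift X u) = (1 / 2 : ℝ) •
        ((α : ℝ) • verticalLift X u
          + √((α : ℝ) ^ 2 + 4 * (β : ℝ)) • horizontalLift nabla X u)

end Lifts

end

/-!
For a smooth connection the horizontal lift `X^H` at `u ∈ T_p M` depends only on the value `X p`.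
Indeed, in the coordinates induced by a chart around `p` one has `X^H = (X p, G (X p))`, where `-G`
is the value at `u` of the difference between `∇` and the coordinate derivative. Both satisfy the
Leibniz rule, so this difference is tensorial (`tensorialAt_connectionDefect`,
`horizontalLift_eq`). As `X^V = (0, X p)`, the space `T_u(TM)` is the direct sum of the horizontal
and the vertical lifts of the tangent vectors at `p`, and every tangent vector is the value of a
global smooth field. Hence there is exactly one endomorphism with the prescribed values on lifts,
namely `J = (α I + √(α² + 4β) K) / 2`, where `K` interchanges horizontal and vertical lifts
(`isMetallicHVTensor_metallicField`, `IsMetallicHVTensor.eq_metallicField`). From `K² = I` one gets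
`J² - α J - β I = 0` (`metallicField_comp_self`).

Smoothness of `J` follows from `contMDiffAt_endomorphism_of_frame`: near any point the lifts of
suitable vector fields form a smooth frame of `T(TM)`, and `J` maps each of its members to a
constant linear combination of members. The lifts of a smooth field are smooth because their
coordinate expressions are valid in the induced coordinates of a fixed chart
(`trivializationAt_vectorVerticalLift`, `trivializationAt_completeLift`), although Mathlib's
identification of `T_u(TM)` with `E × E`, used to define the complete lift, refers to a chart that
varies with `u`.
-/

noncomputable section

open scoped Topology

/-! ### Smoothness tested on a frame -/

section Frames

variable {B : Type*} [NormedAddCommGroup B] [NormedSpace ℝ B] {H : Type*} [TopologicalSpace H]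
  {I : ModelWithCorners ℝ B H} {N : Type*} [TopologicalSpace N] [ChartedSpace H N]
  {F : Type*} [NormedAddCommGroup F] [NormedSpace ℝ F]
  {V : N → Type*} [TopologicalSpace (TotalSpace F V)]
  [∀ x, AddCommGroup (V x)] [∀ x, Module ℝ (V x)] [∀ x, TopologicalSpace (V x)]
  [∀ x, IsTopologicalAddGroup (V x)] [∀ x, ContinuousSMul ℝ (V x)]
  [FiberBundle F V] [VectorBundle ℝ F V]

/-- A field of endomorphisms `A` is smooth at `x₀` as soon as `A` maps smooth sections
`σ i` that form a basis of the fibre at `x₀` to smooth sections. In a trivialization the matrix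
`S` with columns `σ i` is smooth and invertible near `x₀`, and the matrix of `A` is `A S · S⁻¹`. -/
theorem contMDiffAt_endomorphism_of_frame {n : ℕ∞ω} {ι : Type*} [Fintype ι] {x₀ : N}
    (σ : ι → Π x, V x) (b : Module.Basis ι ℝ (V x₀)) (hb : ∀ i, σ i x₀ = b i)
    (hσ : ∀ i, ContMDiffAt I (I.prod 𝓘(ℝ, F)) n (fun x ↦ TotalSpace.mk' F x (σ i x)) x₀)
    (A : Π x, V x →L[ℝ] V x)
    (hA : ∀ i, ContMDiffAt I (I.prod 𝓘(ℝ, F)) n (fun x ↦ TotalSpace.mk' F x (A x (σ i x))) x₀) :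
    ContMDiffAt I (I.prod 𝓘(ℝ, F →L[ℝ] F)) n
      (fun x ↦ TotalSpace.mk' (F →L[ℝ] F) (E := fun y ↦ V y →L[ℝ] V y) x (A x)) x₀ := by
  rw [contMDiffAt_hom_bundle]
  refine ⟨contMDiffAt_id, ?_⟩
  set e := trivializationAt F V x₀ with he
  have he₀ : x₀ ∈ e.baseSet := FiberBundle.mem_baseSet_trivializationAt' x₀
  -- `S τ x` is the matrix whose columns are the coordinates of the `τ i x`
  let S (τ : ι → Π x, V x) (x : N) : (ι → ℝ) →L[ℝ] F :=
    ∑ i, (ContinuousLinearMap.proj (R := ℝ) (φ := fun _ : ι ↦ ℝ) i).smulRight (e ⟨x, τ i x⟩).2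
  have hS (τ : ι → Π x, V x)
      (hτ : ∀ i, ContMDiffAt I (I.prod 𝓘(ℝ, F)) n (fun x ↦ TotalSpace.mk' F x (τ i x)) x₀) :
      ContMDiffAt I 𝓘(ℝ, (ι → ℝ) →L[ℝ] F) n (S τ) x₀ := by
    have hsum : S τ = fun x ↦ ∑ i, ContinuousLinearMap.smulRightL ℝ (ι → ℝ) F
        (ContinuousLinearMap.proj (R := ℝ) (φ := fun _ : ι ↦ ℝ) i) (e ⟨x, τ i x⟩).2 := rfl
    rw [hsum]
    refine contMDiffAt_finsetSum fun i _ ↦ ?_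
    exact (ContinuousLinearMap.contMDiff _).contMDiffAt.comp x₀
      ((contMDiffAt_section x₀).1 (hτ i))
  let Ae : (ι → ℝ) ≃L[ℝ] F :=
    (b.equivFun.symm ≪≫ₗ e.linearEquivAt ℝ x₀ he₀).toContinuousLinearEquiv
  have hAe : S σ x₀ = Ae := by
    ext c
    simp [S, Ae, b.equivFun_symm_apply, hb]
  have hinv : ContMDiffAt I 𝓘(ℝ, F →L[ℝ] (ι → ℝ)) n (fun x ↦ (S σ x).inverse) x₀ := by
    have h := contDiffAt_map_inverse (n := n) Ae
    rw [← hAe] at h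
    exact h.contMDiffAt.comp x₀ (hS σ hσ)
  refine ((hS _ hA).clm_comp hinv).congr_of_eventuallyEq ?_
  have hev : ∀ᶠ x in 𝓝 x₀, (S σ x).IsInvertible := by
    have h := (ContinuousLinearEquiv.nhds Ae)
    rw [← hAe] at h
    filter_upwards [(hS σ hσ).continuousAt.eventually h] with x ⟨L, hL⟩
    exact ⟨L, hL⟩
  filter_upwards [hev, e.open_baseSet.mem_nhds he₀] with x hx hxe
  have hcomp : (ContinuousLinearMap.inCoordinates F V F V x₀ x x₀ x (A x)).comp (S σ x)
      = S (fun i y ↦ A y (σ i y)) x := by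
    ext c
    have hsymm (i : ι) : e.symmL ℝ x (e ⟨x, σ i x⟩).2 = σ i x := by
      rw [e.symmL_apply hxe]
      exact e.symm_proj_apply ⟨x, σ i x⟩ hxe
    simp [S, ContinuousLinearMap.inCoordinates, ← he, hsymm, Bundle.Trivialization.linearMapAt_apply,
      hxe]
  rw [← hcomp, ContinuousLinearMap.comp_assoc]
  obtain ⟨L, hL⟩ := hx
  rw [← hL]
  simp

end Frames

/-! ### Global vector fields with prescribed germ -/

section Extension

variable {E : Type*} [NormedAddCommGroup E] [NormedSpace ℝ E] [FiniteDimensional ℝ E]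
  {M : Type*} [TopologicalSpace M] [T2Space M] [ChartedSpace E M] [IsManifold 𝓘(ℝ, E) ∞ M]

/-- Near `p` there is a frame of global smooth vector fields that is constant in the preferred
chart: any constant vector in that chart, cut off by a bump function, is such a field. -/
theorem exists_contMDiff_localComponents_eventuallyEq (p : M) (w : E) :
    ∃ X : Π q : M, TangentSpace 𝓘(ℝ, E) q,
      ContMDiff 𝓘(ℝ, E) 𝓘(ℝ, E).tangent ∞ (fun q ↦ (⟨q, X q⟩ : TangentBundle 𝓘(ℝ, E) M)) ∧
      ∀ᶠ q in 𝓝 p, localComponents p X q = w := by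
  let e := trivializationAt E (TangentSpace 𝓘(ℝ, E) : M → Type _) p
  obtain ⟨χ⟩ : Nonempty (SmoothBumpFunction 𝓘(ℝ, E) p) := inferInstance
  have he : p ∈ e.baseSet := FiberBundle.mem_baseSet_trivializationAt' p
  refine ⟨(χ : M → ℝ) • fun q ↦ e.symm q w, ?_, ?_⟩
  · refine ContMDiffOn.smul_section_of_tsupport (u := e.baseSet) χ.contMDiff.contMDiffOn
      e.open_baseSet χ.tsupport_subset_chartAt_source ?_
    intro q hq
    rw [e.contMDiffWithinAt_section _ hq]
    refine contMDiffWithinAt_const (c := w) |>.congr (fun y hy ↦ ?_) ?_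
    · exact congrArg Prod.snd (e.apply_mk_symm hy w)
    · exact congrArg Prod.snd (e.apply_mk_symm hq w)
  · filter_upwards [χ.eventuallyEq_one, e.open_baseSet.mem_nhds he] with q hq hqe
    have h1 : ((χ : M → ℝ) • fun q ↦ e.symm q w) q = e.symm q w := by
      simp [hq]
    rw [localComponents, h1]
    exact congrArg Prod.snd (e.apply_mk_symm hqe w)

end Extension

/-! ### Induced coordinates on the tangent bundle -/

section InducedCoordinates

variable {E : Type*} [NormedAddCommGroup E] [NormedSpace ℝ E]
  {M : Type*} [TopologicalSpace M] [ChartedSpace E M]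

/-- The transition map from the preferred chart around `p` to the preferred chart around `p₀`. -/
def chartTransition (p p₀ : M) : E → E :=
  extChartAt 𝓘(ℝ, E) p₀ ∘ (extChartAt 𝓘(ℝ, E) p).symm

theorem chartTransition_contDiffAt {n : ℕ∞ω} [IsManifold 𝓘(ℝ, E) n M] {p p₀ : M}
    (hp : p ∈ (chartAt E p₀).source) :
    ContDiffAt ℝ n (chartTransition p p₀) (extChartAt 𝓘(ℝ, E) p p) := by
  have h := contDiffWithinAt_ext_coord_change (I := 𝓘(ℝ, E)) (n := n) p₀ p
    (y := extChartAt 𝓘(ℝ, E) p p) (by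
      simp [hp])
  simpa [chartTransition, contDiffWithinAt_univ] using h

variable [IsManifold 𝓘(ℝ, E) 1 M]

theorem trivializationAt_snd_eq_fderiv (p₀ : M) (v : TangentBundle 𝓘(ℝ, E) M) :
    (trivializationAt E (TangentSpace 𝓘(ℝ, E)) p₀ v).2 =
      fderiv ℝ (chartTransition v.1 p₀) (extChartAt 𝓘(ℝ, E) v.1 v.1) v.2 := by
  rw [TangentBundle.trivializationAt_apply]
  simp [chartTransition, extChartAt]

/-- Change of coordinates of a tangent vector at `q` between two preferred charts, neither of which
has to be the preferred chart around `q`. -/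
theorem trivializationAt_snd_change {p p₀ q : M} (hq : q ∈ (chartAt E p).source)
    (hq₀ : q ∈ (chartAt E p₀).source) (v : TangentSpace 𝓘(ℝ, E) q) :
    (trivializationAt E (TangentSpace 𝓘(ℝ, E)) p₀ ⟨q, v⟩).2 =
      fderiv ℝ (chartTransition p p₀) (extChartAt 𝓘(ℝ, E) p q)
        (trivializationAt E (TangentSpace 𝓘(ℝ, E)) p ⟨q, v⟩).2 := by
  have h := tangentCoordChange_comp (I := 𝓘(ℝ, E)) (w := q) (x := p) (y := p₀) (z := q) (v := v)
    (by simp [hq, hq₀])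
  simp only [tangentCoordChange_def] at h
  simp only [modelWithCornersSelf_coe, Set.range_id, fderivWithin_univ] at h
  rw [trivializationAt_snd_eq_fderiv, trivializationAt_snd_eq_fderiv]
  exact h.symm

theorem extChartAt_tangentBundle_apply (u₀ v : TangentBundle 𝓘(ℝ, E) M) :
    extChartAt 𝓘(ℝ, E).tangent u₀ v =
      (extChartAt 𝓘(ℝ, E) u₀.1 v.1, (trivializationAt E (TangentSpace 𝓘(ℝ, E)) u₀.1 v).2) := by
  rw [FiberBundle.extChartAt]
  rfl

theorem extChartAt_tangentBundle_mk (p : M) (v : TangentSpace 𝓘(ℝ, E) p) (w : E) :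
    extChartAt 𝓘(ℝ, E).tangent (⟨p, v⟩ : TangentBundle 𝓘(ℝ, E) M) ⟨p, w⟩ =
      (extChartAt 𝓘(ℝ, E) p p, w) := by
  rw [extChartAt_tangentBundle_apply]
  refine Prod.ext rfl ?_
  exact (tangentBundleCore 𝓘(ℝ, E) M).coordChange_self (achart E p) p (mem_chart_source E p) w

/-- The transition maps of `TM` are `(x, y) ↦ (τ x, Dτ_x y)`, with `τ` the transition map
of `M`. -/
theorem extChartAt_tangentBundle_comp_symm_eventuallyEq {u u₀ : TangentBundle 𝓘(ℝ, E) M}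
    (hu : u.1 ∈ (chartAt E u₀.1).source) :
    (extChartAt 𝓘(ℝ, E).tangent u₀ ∘ (extChartAt 𝓘(ℝ, E).tangent u).symm)
      =ᶠ[𝓝 (extChartAt 𝓘(ℝ, E).tangent u u)]
      fun z : E × E ↦ (chartTransition u.1 u₀.1 z.1, fderiv ℝ (chartTransition u.1 u₀.1) z.1 z.2) := by
  set φ := extChartAt 𝓘(ℝ, E) u.1 with hφ
  have hfst : extChartAt 𝓘(ℝ, E).tangent u u = (φ u.1, u.2) :=
    extChartAt_tangentBundle_mk u.1 u.2 u.2
  have h1 : ∀ᶠ x in 𝓝 (φ u.1), x ∈ φ.target :=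
    (isOpen_extChartAt_target u.1).mem_nhds (mem_extChartAt_target u.1)
  have h2 : ∀ᶠ x in 𝓝 (φ u.1), φ.symm x ∈ (chartAt E u₀.1).source := by
    refine (continuousAt_extChartAt_symm u.1).eventually ?_
    rw [extChartAt_to_inv]
    exact (chartAt E u₀.1).open_source.mem_nhds hu
  rw [hfst]
  filter_upwards [continuousAt_fst.eventually (h1.and h2)] with z hz
  obtain ⟨x, y⟩ := z
  obtain ⟨hx, hx₀⟩ := hz
  have hxs : φ.symm x ∈ (chartAt E u.1).source := by
    rw [← extChartAt_source 𝓘(ℝ, E)]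
    exact φ.map_target hx
  have hsymm : (extChartAt 𝓘(ℝ, E).tangent u).symm (x, y) =
      ⟨φ.symm x, (trivializationAt E (TangentSpace 𝓘(ℝ, E)) u.1).symm (φ.symm x) y⟩ := by
    rw [FiberBundle.extChartAt, Bundle.Trivialization.mk_symm _ (by exact hxs)]
    rfl
  rw [Function.comp_apply, hsymm, extChartAt_tangentBundle_apply, trivializationAt_snd_change hxs hx₀,
    φ.right_inv hx, Bundle.Trivialization.apply_mk_symm _ (by exact hxs)]
  rfl

theorem hasFDerivAt_tangent_of_contDiffAt {f : E → E} {x : E} (hf : ContDiffAt ℝ 2 f x) (y : E) :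
    HasFDerivAt (fun z : E × E ↦ (f z.1, fderiv ℝ f z.1 z.2))
      (((fderiv ℝ f x).comp (.fst ℝ E E)).prod
        (((fderiv ℝ (fderiv ℝ f) x).flip y).comp (.fst ℝ E E)
          + (fderiv ℝ f x).comp (.snd ℝ E E))) (x, y) := by
  have h1 : HasFDerivAt f (fderiv ℝ f x) x := (hf.differentiableAt (by norm_num)).hasFDerivAt
  have h2 : HasFDerivAt (fderiv ℝ f) (fderiv ℝ (fderiv ℝ f) x) x :=
    ((hf.fderiv_right (m := 1) (by norm_num)).differentiableAt (by norm_num)).hasFDerivAt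
  have h2' := h2.comp (x, y) (hasFDerivAt_fst (𝕜 := ℝ) (p := (x, y)))
  refine (h1.comp (x, y) hasFDerivAt_fst).prodMk ((h2'.clm_apply hasFDerivAt_snd).congr_fderiv ?_)
  ext z <;> simp

/-- Transformation law for tangent vectors of `TM`: the vector with components `(a, b)` at
`u = (x, y)` in the coordinates induced around `u` has components
`(Dτ a, D²τ(a, y) + Dτ b)` in the coordinates induced around `u₀`. -/
theorem trivializationAt_tangentBundle_snd [IsManifold 𝓘(ℝ, E) 2 M]
    {u u₀ : TangentBundle 𝓘(ℝ, E) M}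
    (hu : u.1 ∈ (chartAt E u₀.1).source) (a b : E) :
    (trivializationAt (E × E) (TangentSpace 𝓘(ℝ, E).tangent) u₀
      (⟨u, (a, b)⟩ : TangentBundle 𝓘(ℝ, E).tangent (TangentBundle 𝓘(ℝ, E) M))).2 =
      (fderiv ℝ (chartTransition u.1 u₀.1) (extChartAt 𝓘(ℝ, E) u.1 u.1) a,
        fderiv ℝ (fderiv ℝ (chartTransition u.1 u₀.1)) (extChartAt 𝓘(ℝ, E) u.1 u.1) a u.2
          + fderiv ℝ (chartTransition u.1 u₀.1) (extChartAt 𝓘(ℝ, E) u.1 u.1) b) := by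
  have hfst : extChartAt 𝓘(ℝ, E).tangent u u = (extChartAt 𝓘(ℝ, E) u.1 u.1, u.2) :=
    extChartAt_tangentBundle_mk u.1 u.2 u.2
  have h : HasFDerivAt
      (fun z : E × E ↦ (chartTransition u.1 u₀.1 z.1, fderiv ℝ (chartTransition u.1 u₀.1) z.1 z.2))
      _ (extChartAt 𝓘(ℝ, E).tangent u u) :=
    Eq.mpr (congrArg (HasFDerivAt _ _) hfst)
      (hasFDerivAt_tangent_of_contDiffAt (chartTransition_contDiffAt (n := 2) hu) u.2)
  have h' := (h.congr_of_eventuallyEq (extChartAt_tangentBundle_comp_symm_eventuallyEq hu)).fderiv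
  rw [TangentBundle.trivializationAt_apply]
  have hr : Set.range (𝓘(ℝ, E).tangent) = Set.univ := by
    simp [ModelWithCorners.tangent]
  rw [hr, fderivWithin_univ]
  have h'' := congr($h' (a, b))
  refine Eq.trans ?_ (h''.trans ?_)
  · rfl
  · rfl

/-- In the coordinates induced by the preferred chart around `π u`, which define Mathlib's
identification of `T_u(TM)` with `E × E`, the vertical lift of `w` is `(0, w)`. -/
theorem vectorVerticalLift_eq (u : TangentBundle 𝓘(ℝ, E) M) (w : TangentSpace 𝓘(ℝ, E) u.1) :
    vectorVerticalLift u w = ((0 : E), (w : E)) := by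
  let ι : E → TangentBundle 𝓘(ℝ, E) M := fun v ↦ ⟨u.1, v⟩
  let y : E := u.2
  have hsnd (v : E) : (trivializationAt E (TangentSpace 𝓘(ℝ, E)) u.1 (ι v)).2 = v :=
    (tangentBundleCore 𝓘(ℝ, E) M).coordChange_self (achart E u.1) u.1 (mem_chart_source E u.1) v
  have hev : writtenInExtChartAt 𝓘(ℝ, E) 𝓘(ℝ, E).tangent y ι
      = fun v : E ↦ (extChartAt 𝓘(ℝ, E) u.1 u.1, v) := by
    funext v
    exact extChartAt_tangentBundle_mk u.1 u.2 v
  have hd : MDifferentiableAt 𝓘(ℝ, E) 𝓘(ℝ, E).tangent ι y := by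
    rw [mdifferentiableAt_totalSpace]
    refine ⟨mdifferentiableAt_const (c := u.1), ?_⟩
    exact (mdifferentiableAt_id (I := 𝓘(ℝ, E)) (x := y)).congr_of_eventuallyEq
      (Filter.Eventually.of_forall hsnd)
  have hf : mfderiv 𝓘(ℝ, E) 𝓘(ℝ, E).tangent ι y = ContinuousLinearMap.inr ℝ E E := by
    rw [hd.mfderiv, hev]
    simp only [modelWithCornersSelf_coe, Set.range_id, fderivWithin_univ]
    exact ((hasFDerivAt_const _ _).prodMk (hasFDerivAt_id _)).fderiv
  exact congr($hf w)

end InducedCoordinates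

/-! ### Coordinate expressions of the lifts -/

section LiftCoordinates

variable {E : Type*} [NormedAddCommGroup E] [NormedSpace ℝ E]
  {M : Type*} [TopologicalSpace M] [ChartedSpace E M]

theorem mfderiv_eq_fderiv_comp_symm {f : M → E} {p : M}
    (hf : MDifferentiableAt 𝓘(ℝ, E) 𝓘(ℝ, E) f p) :
    mfderiv 𝓘(ℝ, E) 𝓘(ℝ, E) f p =
      fderiv ℝ (f ∘ (extChartAt 𝓘(ℝ, E) p).symm) (extChartAt 𝓘(ℝ, E) p p) := by
  rw [hf.mfderiv]
  simp only [writtenInExtChartAt, extChartAt_model_space_eq_id, modelWithCornersSelf_coe,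
    Set.range_id, fderivWithin_univ]
  rfl

theorem differentiableAt_comp_symm {f : M → E} {p : M}
    (hf : MDifferentiableAt 𝓘(ℝ, E) 𝓘(ℝ, E) f p) :
    DifferentiableAt ℝ (f ∘ (extChartAt 𝓘(ℝ, E) p).symm) (extChartAt 𝓘(ℝ, E) p p) := by
  have h := hf.differentiableWithinAt_writtenInExtChartAt
  simp only [writtenInExtChartAt, extChartAt_model_space_eq_id, modelWithCornersSelf_coe,
    Set.range_id, differentiableWithinAt_univ] at h
  exact h

variable [IsManifold 𝓘(ℝ, E) 1 M]

/-- The components of a vector field in two charts are related by the derivative of the transition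
map. -/
theorem localComponents_comp_symm_eventuallyEq {p p₀ : M} (hp : p ∈ (chartAt E p₀).source)
    (X : Π q : M, TangentSpace 𝓘(ℝ, E) q) :
    localComponents p₀ X ∘ (extChartAt 𝓘(ℝ, E) p).symm =ᶠ[𝓝 (extChartAt 𝓘(ℝ, E) p p)]
      fun x ↦ fderiv ℝ (chartTransition p p₀) x
        ((localComponents p X ∘ (extChartAt 𝓘(ℝ, E) p).symm) x) := by
  have h1 : ∀ᶠ x in 𝓝 (extChartAt 𝓘(ℝ, E) p p), x ∈ (extChartAt 𝓘(ℝ, E) p).target :=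
    (isOpen_extChartAt_target p).mem_nhds (mem_extChartAt_target p)
  have h2 : ∀ᶠ x in 𝓝 (extChartAt 𝓘(ℝ, E) p p),
      (extChartAt 𝓘(ℝ, E) p).symm x ∈ (chartAt E p₀).source := by
    refine (continuousAt_extChartAt_symm p).eventually ?_
    rw [extChartAt_to_inv]
    exact (chartAt E p₀).open_source.mem_nhds hp
  filter_upwards [h1, h2] with x hx hx₀
  have hxs : (extChartAt 𝓘(ℝ, E) p).symm x ∈ (chartAt E p).source := by
    rw [← extChartAt_source 𝓘(ℝ, E)]
    exact (extChartAt 𝓘(ℝ, E) p).map_target hx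
  have h := trivializationAt_snd_change hxs hx₀ (X _)
  rwa [(extChartAt 𝓘(ℝ, E) p).right_inv hx] at h

theorem mdifferentiableAt_localComponents [IsManifold 𝓘(ℝ, E) 2 M]
    {X : Π q : M, TangentSpace 𝓘(ℝ, E) q} {p p₀ : M}
    (hp : p ∈ (chartAt E p₀).source)
    (hX : MDifferentiableAt 𝓘(ℝ, E) 𝓘(ℝ, E).tangent
      (fun q ↦ (⟨q, X q⟩ : TangentBundle 𝓘(ℝ, E) M)) p) :
    MDifferentiableAt 𝓘(ℝ, E) 𝓘(ℝ, E) (localComponents p₀ X) p :=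
  ((trivializationAt E (TangentSpace 𝓘(ℝ, E)) p₀).mdifferentiableAt_section_iff 𝓘(ℝ, E) X hp).1 hX

/-- The local expression of the complete lift holds in the induced coordinates around any `u₀`, not
only around `u`. Symmetry of the second derivative of the transition map makes the second order
terms cancel. -/
theorem trivializationAt_completeLift [IsManifold 𝓘(ℝ, E) 2 M]
    {X : Π q : M, TangentSpace 𝓘(ℝ, E) q}
    {u u₀ : TangentBundle 𝓘(ℝ, E) M} (hu : u.1 ∈ (chartAt E u₀.1).source)
    (hX : MDifferentiableAt 𝓘(ℝ, E) 𝓘(ℝ, E).tangent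
      (fun q ↦ (⟨q, X q⟩ : TangentBundle 𝓘(ℝ, E) M)) u.1) :
    (trivializationAt (E × E) (TangentSpace 𝓘(ℝ, E).tangent) u₀
      (⟨u, completeLift X u⟩ : TangentBundle 𝓘(ℝ, E).tangent (TangentBundle 𝓘(ℝ, E) M))).2 =
      (localComponents u₀.1 X u.1, mfderiv 𝓘(ℝ, E) 𝓘(ℝ, E) (localComponents u₀.1 X) u.1 u.2) := by
  have h := mdifferentiableAt_localComponents  (mem_chart_source E (u.1 : M)) hX
  have h₀ := mdifferentiableAt_localComponents hu hX
  set x := extChartAt 𝓘(ℝ, E) u.1 u.1 with hx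
  set τ : E → E := chartTransition u.1 u₀.1 with hτdef
  have hτ : ContDiffAt ℝ 2 τ x := chartTransition_contDiffAt hu
  have hself : (localComponents u.1 X ∘ (extChartAt 𝓘(ℝ, E) u.1).symm) x = X u.1 := by
    rw [Function.comp_apply, hx, extChartAt_to_inv]
    exact (tangentBundleCore 𝓘(ℝ, E) M).coordChange_self (achart E u.1) u.1
      (mem_chart_source E u.1) (X u.1)
  have hD : HasFDerivAt (fderiv ℝ τ) (fderiv ℝ (fderiv ℝ τ) x) x :=
    ((hτ.fderiv_right (m := 1) (by norm_num)).differentiableAt (by norm_num)).hasFDerivAt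
  have hder := ((hD.clm_apply (differentiableAt_comp_symm h).hasFDerivAt).congr_of_eventuallyEq
    (localComponents_comp_symm_eventuallyEq hu X)).fderiv
  have hsymm : IsSymmSndFDerivAt ℝ τ x := hτ.isSymmSndFDerivAt (by simp)
  refine (trivializationAt_tangentBundle_snd hu _ _).trans ?_
  refine Prod.ext (trivializationAt_snd_eq_fderiv u₀.1 ⟨u.1, X u.1⟩).symm ?_
  rw [mfderiv_eq_fderiv_comp_symm h₀, mfderiv_eq_fderiv_comp_symm h]
  refine Eq.trans ?_ congr($hder u.2).symm
  have hs := hsymm (X u.1) u.2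
  let f : E → E := localComponents u.1 X ∘ (extChartAt 𝓘(ℝ, E) u.1).symm
  change fderiv ℝ (fderiv ℝ τ) x (X u.1) u.2 + fderiv ℝ τ x (fderiv ℝ f x u.2) =
    fderiv ℝ τ x (fderiv ℝ f x u.2) + fderiv ℝ (fderiv ℝ τ) x u.2 (f x)
  rw [hs, add_comm]
  exact congrArg (fun a : E ↦ fderiv ℝ τ x (fderiv ℝ f x u.2) + fderiv ℝ (fderiv ℝ τ) x u.2 a)
    hself.symm

theorem trivializationAt_vectorVerticalLift [IsManifold 𝓘(ℝ, E) 2 M]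
    {u u₀ : TangentBundle 𝓘(ℝ, E) M} (hu : u.1 ∈ (chartAt E u₀.1).source)
    (w : TangentSpace 𝓘(ℝ, E) u.1) :
    (trivializationAt (E × E) (TangentSpace 𝓘(ℝ, E).tangent) u₀
      (⟨u, vectorVerticalLift u w⟩ :
        TangentBundle 𝓘(ℝ, E).tangent (TangentBundle 𝓘(ℝ, E) M))).2 =
      ((0 : E), (trivializationAt E (TangentSpace 𝓘(ℝ, E)) u₀.1 ⟨u.1, w⟩).2) := by
  rw [vectorVerticalLift_eq, trivializationAt_snd_eq_fderiv]
  refine (trivializationAt_tangentBundle_snd hu _ _).trans ?_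
  rw [map_zero, map_zero]
  exact congrArg _ (zero_add _)

end LiftCoordinates

/-! ### The horizontal subspaces -/

section ConnectionForm

variable {E : Type*} [NormedAddCommGroup E] [NormedSpace ℝ E]
  {M : Type*} [TopologicalSpace M] [ChartedSpace E M]

theorem localComponents_self [IsManifold 𝓘(ℝ, E) 1 M] (X : Π q : M, TangentSpace 𝓘(ℝ, E) q)
    (p : M) : localComponents p X p = X p :=
  (tangentBundleCore 𝓘(ℝ, E) M).coordChange_self (achart E p) p (mem_chart_source E p) (X p)

theorem localComponents_add [IsManifold 𝓘(ℝ, E) 1 M] (p : M)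
    (X Y : Π q : M, TangentSpace 𝓘(ℝ, E) q) :
    localComponents p (X + Y) = localComponents p X + localComponents p Y := by
  funext q
  simp only [localComponents, trivializationAt_snd_eq_fderiv, Pi.add_apply]
  exact map_add (fderiv ℝ (chartTransition q p) (extChartAt 𝓘(ℝ, E) q q)) (X q : E) (Y q : E)

theorem localComponents_smul [IsManifold 𝓘(ℝ, E) 1 M] (p : M) (f : M → ℝ)
    (X : Π q : M, TangentSpace 𝓘(ℝ, E) q) :
    localComponents p (f • X) = f • localComponents p X := by
  funext q
  simp only [localComponents, trivializationAt_snd_eq_fderiv, Pi.smul_apply']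
  exact map_smul (fderiv ℝ (chartTransition q p) (extChartAt 𝓘(ℝ, E) q q)) (f q) (X q : E)

variable [IsManifold 𝓘(ℝ, E) 1 M]
  (nabla : CovariantDerivative 𝓘(ℝ, E) E (TangentSpace 𝓘(ℝ, E) : M → Type _))

/-- The difference at `p` between the covariant derivative of `X` and the derivative of the
components of `X` in the preferred chart around `p`. In coordinates this is
`v ↦ Γ^h_{li} v^l X^i`. -/
def connectionDefect (p : M) (X : Π q : M, TangentSpace 𝓘(ℝ, E) q) : E →L[ℝ] E :=
  let D : E →L[ℝ] E := nabla X p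
  let D' : E →L[ℝ] E := mvfderiv 𝓘(ℝ, E) (localComponents p X) p
  D - D'

/-- Both `∇` and the coordinate derivative satisfy the Leibniz rule, so their difference depends
on `X` only through its value at `p`. -/
theorem tensorialAt_connectionDefect [IsManifold 𝓘(ℝ, E) 2 M] (p : M) :
    TensorialAt 𝓘(ℝ, E) E (connectionDefect nabla p) p where
  smul {f X} hf hX := by
    have hd := mdifferentiableAt_localComponents (mem_chart_source E p) hX
    have h1 := nabla.isCovariantDerivativeOnUniv.leibniz hX hf
    have h2 : mvfderiv 𝓘(ℝ, E) (localComponents p (f • X)) p =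
        f p • mvfderiv 𝓘(ℝ, E) (localComponents p X) p +
          (mvfderiv 𝓘(ℝ, E) f p).smulRight (show E from X p) := by
      rw [localComponents_smul, mvfderiv_smul hf hd, localComponents_self]
    let D : E →L[ℝ] E := nabla X p
    let D' : E →L[ℝ] E := mvfderiv 𝓘(ℝ, E) (localComponents p X) p
    let R : E →L[ℝ] E := (mvfderiv 𝓘(ℝ, E) f p).smulRight (show E from X p)
    have h3 : connectionDefect nabla p (f • X) = (f p • D + R) - (f p • D' + R) :=
      congrArg₂ (fun A B : E →L[ℝ] E ↦ A - B) h1 h2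
    change _ = f p • (D - D')
    rw [h3]
    module
  add {X Y} hX hY := by
    have hdX := mdifferentiableAt_localComponents (mem_chart_source E p) hX
    have hdY := mdifferentiableAt_localComponents (mem_chart_source E p) hY
    have h1 := nabla.isCovariantDerivativeOnUniv.add hX hY
    have h2 : mvfderiv 𝓘(ℝ, E) (localComponents p (X + Y)) p =
        mvfderiv 𝓘(ℝ, E) (localComponents p X) p + mvfderiv 𝓘(ℝ, E) (localComponents p Y) p := by
      rw [localComponents_add, mvfderiv_add hdX hdY]
    let D₁ : E →L[ℝ] E := nabla X p
    let D₂ : E →L[ℝ] E := nabla Y p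
    let D₁' : E →L[ℝ] E := mvfderiv 𝓘(ℝ, E) (localComponents p X) p
    let D₂' : E →L[ℝ] E := mvfderiv 𝓘(ℝ, E) (localComponents p Y) p
    have h3 : connectionDefect nabla p (X + Y) = (D₁ + D₂) - (D₁' + D₂') :=
      congrArg₂ (fun A B : E →L[ℝ] E ↦ A - B) h1 h2
    change _ = (D₁ - D₁') + (D₂ - D₂')
    rw [h3]
    abel

variable [IsManifold 𝓘(ℝ, E) 2 M] [FiniteDimensional ℝ E]

/-- The second component, as a linear function of `X p`, of the horizontal lift `X^H` at `u ∈ T_p M`;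
in coordinates `w ↦ -Γ^h_{li} y^l w^i`. It describes the horizontal subspace of `T_u(TM)` as
a graph. -/
def horizontalComponent (u : TangentBundle 𝓘(ℝ, E) M) : E →L[ℝ] E :=
  let Γ : E →L[ℝ] E →L[ℝ] E :=
    -TensorialAt.mkHom (connectionDefect nabla u.1) u.1 (tensorialAt_connectionDefect nabla u.1)
  Γ.flip u.2

/-- `X^H` at `u` depends only on the value of `X` at `π u`. -/
theorem horizontalLift_eq {X : Π q : M, TangentSpace 𝓘(ℝ, E) q} {u : TangentBundle 𝓘(ℝ, E) M}
    (hX : MDifferentiableAt 𝓘(ℝ, E) 𝓘(ℝ, E).tangent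
      (fun q ↦ (⟨q, X q⟩ : TangentBundle 𝓘(ℝ, E) M)) u.1) :
    horizontalLift nabla X u = ((X u.1 : E), horizontalComponent nabla u (X u.1)) := by
  have h : horizontalComponent nabla u (X u.1) = -(connectionDefect nabla u.1 X u.2) :=
    congr(-$(TensorialAt.mkHom_apply (tensorialAt_connectionDefect nabla u.1) hX) u.2)
  rw [h, horizontalLift, vectorVerticalLift_eq]
  refine Prod.ext (sub_zero (X u.1 : E)) ?_
  exact (neg_sub (α := E) _ _).symm

end ConnectionForm

/-! ### Existence and uniqueness of the tensor field -/

section MetallicField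

variable {E : Type*} [NormedAddCommGroup E] [NormedSpace ℝ E] [FiniteDimensional ℝ E]
  {M : Type*} [TopologicalSpace M] [ChartedSpace E M] [IsManifold 𝓘(ℝ, E) ∞ M]
  (nabla : CovariantDerivative 𝓘(ℝ, E) E (TangentSpace 𝓘(ℝ, E) : M → Type _))

/-- The endomorphism of `T_u(TM) = E × E` that interchanges horizontal and vertical lifts. The
horizontal lift of `w` is `(w, G w)`, so `(a, b)` splits as the horizontal lift of `a` plus the
vertical lift of `b - G a`, and its image is the horizontal lift of `b - G a` plus the vertical
lift of `a`. -/
def liftSwap (u : TangentBundle 𝓘(ℝ, E) M) : E × E →L[ℝ] E × E :=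
  let G := horizontalComponent nabla u
  let V : E × E →L[ℝ] E := .snd ℝ E E - G.comp (.fst ℝ E E)
  V.prod (G.comp V + .fst ℝ E E)

theorem liftSwap_horizontal (u : TangentBundle 𝓘(ℝ, E) M) (w : E) :
    liftSwap nabla u (w, horizontalComponent nabla u w) = (0, w) := by
  simp [liftSwap]

theorem liftSwap_vertical (u : TangentBundle 𝓘(ℝ, E) M) (w : E) :
    liftSwap nabla u (0, w) = (w, horizontalComponent nabla u w) := by
  simp [liftSwap]

theorem liftSwap_liftSwap (u : TangentBundle 𝓘(ℝ, E) M) (z : E × E) :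
    liftSwap nabla u (liftSwap nabla u z) = z := by
  simp [liftSwap]

/-- The tensor field `(α I + √(α² + 4β) K) / 2` on `TM`, where `K` is `liftSwap`. -/
def metallicField (α β : ℕ) : EndField 𝓘(ℝ, E).tangent (TangentBundle 𝓘(ℝ, E) M) :=
  fun u ↦ ((1 / 2 : ℝ) • ((α : ℝ) • ContinuousLinearMap.id ℝ (E × E)
    + √((α : ℝ) ^ 2 + 4 * (β : ℝ)) • liftSwap nabla u) : E × E →L[ℝ] E × E)

theorem metallicField_apply (α β : ℕ) (u : TangentBundle 𝓘(ℝ, E) M) (z : E × E) :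
    metallicField nabla α β u z = ((1 / 2 : ℝ) • ((α : ℝ) • z
      + √((α : ℝ) ^ 2 + 4 * (β : ℝ)) • liftSwap nabla u z) : E × E) := rfl

theorem isMetallicHVTensor_metallicField (α β : ℕ) :
    IsMetallicHVTensor α β nabla (metallicField nabla α β) where
  map_horizontal X hX u := by
    have h := horizontalLift_eq nabla ((hX u.1).mdifferentiableAt (by simp))
    rw [h, verticalLift, vectorVerticalLift_eq]
    refine (metallicField_apply nabla α β u _).trans ?_
    let w : E := X u.1
    exact congrArg (fun z : E × E ↦ (1 / 2 : ℝ) • ((α : ℝ) • (w, horizontalComponent nabla u w)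
      + √((α : ℝ) ^ 2 + 4 * (β : ℝ)) • z)) (liftSwap_horizontal nabla u w)
  map_vertical X hX u := by
    have h := horizontalLift_eq nabla ((hX u.1).mdifferentiableAt (by simp))
    rw [h, verticalLift, vectorVerticalLift_eq]
    refine (metallicField_apply nabla α β u _).trans ?_
    let w : E := X u.1
    exact congrArg (fun z : E × E ↦ (1 / 2 : ℝ) • ((α : ℝ) • ((0 : E), w)
      + √((α : ℝ) ^ 2 + 4 * (β : ℝ)) • z)) (liftSwap_vertical nabla u w)

theorem metallicField_comp_self (α β : ℕ) (u : TangentBundle 𝓘(ℝ, E) M) :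
    (metallicField nabla α β u).comp (metallicField nabla α β u)
      - (α : ℝ) • metallicField nabla α β u
      - (β : ℝ) • ContinuousLinearMap.id ℝ (TangentSpace 𝓘(ℝ, E).tangent u) = 0 := by
  set s := √((α : ℝ) ^ 2 + 4 * (β : ℝ)) with hs
  have hss : s * s = (α : ℝ) ^ 2 + 4 * (β : ℝ) := Real.mul_self_sqrt (by positivity)
  let K := liftSwap nabla u
  let A : E × E →L[ℝ] E × E := (1 / 2 : ℝ) • ((α : ℝ) • ContinuousLinearMap.id ℝ (E × E) + s • K)
  change A.comp A - (α : ℝ) • A - (β : ℝ) • ContinuousLinearMap.id ℝ (E × E) = 0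
  refine ContinuousLinearMap.ext fun z ↦ ?_
  have hK : K (K z) = z := liftSwap_liftSwap nabla u z
  have h : (A.comp A - (α : ℝ) • A - (β : ℝ) • ContinuousLinearMap.id ℝ (E × E)) z
      = ((1 / 4 : ℝ) * (s * s) - (1 / 4 : ℝ) * α ^ 2 - β) • z := by
    simp only [A, sub_apply, ContinuousLinearMap.comp_apply,
      smul_apply, add_apply, map_add, map_smul, hK,
      ContinuousLinearMap.id_apply]
    module
  rw [h, hss]
  have : (1 / 4 : ℝ) * ((α : ℝ) ^ 2 + 4 * β) - (1 / 4 : ℝ) * α ^ 2 - β = 0 := by ring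
  rw [this, zero_smul]
  rfl

variable [T2Space M]

theorem exists_contMDiff_apply_eq (p : M) (w : TangentSpace 𝓘(ℝ, E) p) :
    ∃ X : Π q : M, TangentSpace 𝓘(ℝ, E) q,
      ContMDiff 𝓘(ℝ, E) 𝓘(ℝ, E).tangent ∞ (fun q ↦ (⟨q, X q⟩ : TangentBundle 𝓘(ℝ, E) M)) ∧
      X p = w := by
  obtain ⟨X, hX, hXp⟩ := exists_contMDiff_localComponents_eventuallyEq (E := E) p w
  exact ⟨X, hX, (localComponents_self X p).symm.trans hXp.self_of_nhds⟩

/-- Uniqueness: the lifts of global smooth vector fields span each tangent space of `TM`. -/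
theorem IsMetallicHVTensor.eq_metallicField {α β : ℕ}
    {J : EndField 𝓘(ℝ, E).tangent (TangentBundle 𝓘(ℝ, E) M)}
    (hJ : IsMetallicHVTensor α β nabla J) : J = metallicField nabla α β := by
  have hJ' := isMetallicHVTensor_metallicField nabla α β
  funext u
  refine ContinuousLinearMap.ext fun z ↦ ?_
  obtain ⟨a, b⟩ : E × E := z
  obtain ⟨X, hX, hXu⟩ := exists_contMDiff_apply_eq u.1 a
  obtain ⟨Y, hY, hYu⟩ := exists_contMDiff_apply_eq u.1 (b - horizontalComponent nabla u a)
  have hz : ((a, b) : E × E) = horizontalLift nabla X u + verticalLift Y u := by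
    rw [horizontalLift_eq nabla ((hX u.1).mdifferentiableAt (by simp)), verticalLift,
      vectorVerticalLift_eq, hXu, hYu]
    refine Prod.ext (add_zero a).symm ?_
    exact (add_sub_cancel (horizontalComponent nabla u a) b).symm
  have h (A : EndField 𝓘(ℝ, E).tangent (TangentBundle 𝓘(ℝ, E) M)) :
      A u ((a, b) : E × E) = A u (horizontalLift nabla X u) + A u (verticalLift Y u) :=
    (congrArg (A u) hz).trans (map_add (A u) _ _)
  refine (h J).trans (Eq.trans ?_ (h (metallicField nabla α β)).symm)
  rw [hJ.map_horizontal X hX u, hJ.map_vertical Y hY u, hJ'.map_horizontal X hX u,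
    hJ'.map_vertical Y hY u]

end MetallicField

/-! ### Smoothness of the lifts -/

section Smoothness

variable {E : Type*} [NormedAddCommGroup E] [NormedSpace ℝ E]
  {M : Type*} [TopologicalSpace M] [ChartedSpace E M] [IsManifold 𝓘(ℝ, E) ∞ M]
  (nabla : CovariantDerivative 𝓘(ℝ, E) E (TangentSpace 𝓘(ℝ, E) : M → Type _))

theorem eventually_fst_mem_chart_source (u₀ : TangentBundle 𝓘(ℝ, E) M) :
    ∀ᶠ u : TangentBundle 𝓘(ℝ, E) M in 𝓝 u₀, u.1 ∈ (chartAt E u₀.1).source :=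
  (FiberBundle.continuous_proj E (TangentSpace 𝓘(ℝ, E) : M → Type _)).continuousAt.eventually
    ((chartAt E u₀.1).open_source.mem_nhds (mem_chart_source E u₀.1))

theorem contMDiffAt_verticalLift {X : Π q : M, TangentSpace 𝓘(ℝ, E) q}
    (hX : ContMDiff 𝓘(ℝ, E) 𝓘(ℝ, E).tangent ∞
      (fun q ↦ (⟨q, X q⟩ : TangentBundle 𝓘(ℝ, E) M))) (u₀ : TangentBundle 𝓘(ℝ, E) M) :
    ContMDiffAt 𝓘(ℝ, E).tangent 𝓘(ℝ, E).tangent.tangent ∞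
      (fun u ↦ (⟨u, verticalLift X u⟩ :
        TangentBundle 𝓘(ℝ, E).tangent (TangentBundle 𝓘(ℝ, E) M))) u₀ := by
  have hloc : ContMDiffAt 𝓘(ℝ, E).tangent 𝓘(ℝ, E) ∞
      (fun u : TangentBundle 𝓘(ℝ, E) M ↦ localComponents u₀.1 X u.1) u₀ :=
    ((contMDiffAt_section u₀.1).1 (hX u₀.1)).comp u₀ (contMDiffAt_proj _)
  refine (contMDiffAt_section u₀).2 ?_
  refine ((contMDiffAt_const (c := (0 : E))).prodMk_space hloc).congr_of_eventuallyEq ?_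
  filter_upwards [eventually_fst_mem_chart_source u₀] with u hu
  exact trivializationAt_vectorVerticalLift hu (X u.1)

/-- In induced coordinates around `u₀`, `X^H` has components `X^h` and
`y^l ∂_l X^h - (∇_y X)^h`, which are smooth because `X` and `∇ X` are. -/
theorem contMDiffAt_horizontalLift [CovariantDerivative.ContMDiffCovariantDerivative nabla ∞]
    {X : Π q : M, TangentSpace 𝓘(ℝ, E) q}
    (hX : ContMDiff 𝓘(ℝ, E) 𝓘(ℝ, E).tangent ∞
      (fun q ↦ (⟨q, X q⟩ : TangentBundle 𝓘(ℝ, E) M))) (u₀ : TangentBundle 𝓘(ℝ, E) M) :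
    ContMDiffAt 𝓘(ℝ, E).tangent 𝓘(ℝ, E).tangent.tangent ∞
      (fun u ↦ (⟨u, horizontalLift nabla X u⟩ :
        TangentBundle 𝓘(ℝ, E).tangent (TangentBundle 𝓘(ℝ, E) M))) u₀ := by
  have hX' := hX.mdifferentiable (by simp)
  have hloc : ContMDiffAt 𝓘(ℝ, E).tangent 𝓘(ℝ, E) ∞
      (fun u : TangentBundle 𝓘(ℝ, E) M ↦ localComponents u₀.1 X u.1) u₀ :=
    ((contMDiffAt_section u₀.1).1 (hX u₀.1)).comp u₀ (contMDiffAt_proj _)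
  have hlocOn : ContMDiffOn 𝓘(ℝ, E) 𝓘(ℝ, E) ∞ (localComponents u₀.1 X) (chartAt E u₀.1).source :=
    fun q hq ↦ (((trivializationAt E (TangentSpace 𝓘(ℝ, E)) u₀.1).contMDiffAt_section_iff
      (s := X) hq).1 (hX q)).contMDiffWithinAt
  have hder : ContMDiffAt 𝓘(ℝ, E).tangent 𝓘(ℝ, E) ∞
      (fun u : TangentBundle 𝓘(ℝ, E) M ↦
        (mfderiv 𝓘(ℝ, E) 𝓘(ℝ, E) (localComponents u₀.1 X) u.1 u.2 : E)) u₀ := by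
    have hT := (hlocOn.contMDiffOn_tangentMapWithin (m := ∞) (by simp)
      (chartAt E u₀.1).open_source.uniqueMDiffOn).contMDiffAt (eventually_fst_mem_chart_source u₀)
    refine (contMDiff_snd_tangentBundle_modelSpace E 𝓘(ℝ, E)).contMDiffAt.comp u₀ hT
      |>.congr_of_eventuallyEq ?_
    filter_upwards [eventually_fst_mem_chart_source u₀] with u hu
    exact congr($(mfderivWithin_of_isOpen (chartAt E u₀.1).open_source hu) u.2).symm
  have hcov : ContMDiffAt 𝓘(ℝ, E).tangent 𝓘(ℝ, E) ∞
      (fun u : TangentBundle 𝓘(ℝ, E) M ↦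
        (trivializationAt E (TangentSpace 𝓘(ℝ, E)) u₀.1 ⟨u.1, nabla X u.1 u.2⟩).2) u₀ := by
    have h := (CovariantDerivative.ContMDiffCovariantDerivative.contMDiff (cov := nabla)
      (k := ∞)).contMDiff (σ := X) hX.contMDiffOn
    have h' := ((contMDiffOn_univ.1 h) u₀.1).comp u₀
      (contMDiffAt_proj (TangentSpace 𝓘(ℝ, E) : M → Type _) (p := u₀))
    have hid : ContMDiffAt 𝓘(ℝ, E).tangent 𝓘(ℝ, E).tangent ∞
      (fun u : TangentBundle 𝓘(ℝ, E) M ↦ (⟨u.1, u.2⟩ : TangentBundle 𝓘(ℝ, E) M)) u₀ :=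
      contMDiffAt_id
    exact (contMDiffAt_totalSpace.1 (ContMDiffAt.clm_bundle_apply
      (b := fun u : TangentBundle 𝓘(ℝ, E) M ↦ u.1) (ϕ := fun u ↦ nabla X u.1) h' hid)).2
  refine (contMDiffAt_section u₀).2 ?_
  refine (hloc.prodMk_space (hder.sub hcov)).congr_of_eventuallyEq ?_
  filter_upwards [eventually_fst_mem_chart_source u₀] with u hu
  have hC := trivializationAt_completeLift hu (hX' u.1)
  have hV := trivializationAt_vectorVerticalLift hu (nabla X u.1 u.2)
  let L := (trivializationAt (E × E) (TangentSpace 𝓘(ℝ, E).tangent) u₀).linearMapAt ℝ u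
  have hL (z : TangentSpace 𝓘(ℝ, E).tangent u) :
      (trivializationAt (E × E) (TangentSpace 𝓘(ℝ, E).tangent) u₀
        (⟨u, z⟩ : TangentBundle 𝓘(ℝ, E).tangent (TangentBundle 𝓘(ℝ, E) M))).2 = L z := by
    have hbase : u ∈ (trivializationAt (E × E) (TangentSpace 𝓘(ℝ, E).tangent) u₀).baseSet := by
      simpa using hu
    exact congrFun (Bundle.Trivialization.coe_linearMapAt_of_mem _ hbase).symm z
  rw [hL] at hC hV
  rw [hL, horizontalLift, map_sub, hC, hV]
  exact Prod.ext (sub_zero _) rfl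

end Smoothness

/-! ### The metallic structure on the tangent bundle -/

section MetallicStructure
variable {E : Type*} [NormedAddCommGroup E] [NormedSpace ℝ E] [FiniteDimensional ℝ E]
  {M : Type*} [TopologicalSpace M] [T2Space M] [ChartedSpace E M] [IsManifold 𝓘(ℝ, E) ∞ M]
  (nabla : CovariantDerivative 𝓘(ℝ, E) E (TangentSpace 𝓘(ℝ, E) : M → Type _))

/-- Smoothness is tested on the frame of horizontal and vertical lifts of global vector fields
whose values at `π u₀` form a basis of the tangent space. -/
theorem isMetallicStructure_metallicField
    [CovariantDerivative.ContMDiffCovariantDerivative nabla ∞] (α β : ℕ) :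
    IsMetallicStructure α β (metallicField nabla α β) where
  equation := metallicField_comp_self nabla α β
  smooth u₀ := by
    let b₀ := Module.finBasis ℝ E
    choose X hX hXu using fun i ↦ exists_contMDiff_apply_eq (E := E) u₀.1 (b₀ i)
    let b : Module.Basis (Fin _ ⊕ Fin _) ℝ (E × E) := (b₀.prod b₀).map
      ((LinearEquiv.refl ℝ E).skewProd (LinearEquiv.refl ℝ E)
        (horizontalComponent nabla u₀ : E →ₗ[ℝ] E))
    have hJ := isMetallicHVTensor_metallicField nabla α β
    have hH (i) := contMDiffAt_horizontalLift nabla (hX i) u₀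
    have hV (i) := contMDiffAt_verticalLift (hX i) u₀
    refine contMDiffAt_endomorphism_of_frame
      (fun i u ↦ Sum.elim (fun i ↦ horizontalLift nabla (X i) u) (fun i ↦ verticalLift (X i) u) i)
      b ?_ ?_ _ ?_
    · rintro (i | i)
      · simp only [Sum.elim_inl]
        rw [horizontalLift_eq nabla ((hX i u₀.1).mdifferentiableAt (by simp)), hXu]
        exact (by simp [b] : ((b₀ i, horizontalComponent nabla u₀ (b₀ i)) : E × E) = b (.inl i))
      · simp only [Sum.elim_inr]
        rw [verticalLift, vectorVerticalLift_eq, hXu]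
        exact (by simp [b] : ((0, b₀ i) : E × E) = b (.inr i))
    · rintro (i | i)
      · exact hH i
      · exact hV i
    · rintro (i | i)
      · simp only [Sum.elim_inl, hJ.map_horizontal _ (hX i)]
        exact ((((hH i).const_smul_section (a := (α : ℝ))).add_section
          ((hV i).const_smul_section (a := √((α : ℝ) ^ 2 + 4 * (β : ℝ))))).const_smul_section
          (a := (1 / 2 : ℝ)))
      · simp only [Sum.elim_inr, hJ.map_vertical _ (hX i)]
        exact ((((hV i).const_smul_section (a := (α : ℝ))).add_section
          ((hH i).const_smul_section (a := √((α : ℝ) ^ 2 + 4 * (β : ℝ))))).const_smul_section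
          (a := (1 / 2 : ℝ)))

end MetallicStructure

end

theorem theorem5p2 {E : Type*} [NormedAddCommGroup E] [NormedSpace ℝ E] [FiniteDimensional ℝ E]
    {M : Type*} [TopologicalSpace M] [T2Space M] [ChartedSpace E M] [IsManifold 𝓘(ℝ, E) ∞ M]
    (α β : ℕ) (hα : 0 < α) (hβ : 0 < β)
    (Ψ : EndField 𝓘(ℝ, E) M) (hΨ : IsMetallicStructure α β Ψ)
    (nabla : CovariantDerivative 𝓘(ℝ, E) E (TangentSpace 𝓘(ℝ, E) : M → Type _))
    [CovariantDerivative.ContMDiffCovariantDerivative nabla ∞] :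
    (∃! J : EndField 𝓘(ℝ, E).tangent (TangentBundle 𝓘(ℝ, E) M), IsMetallicHVTensor α β nabla J) ∧
      ∀ J : EndField 𝓘(ℝ, E).tangent (TangentBundle 𝓘(ℝ, E) M),
        IsMetallicHVTensor α β nabla J → IsMetallicStructure α β J := by
  have hJ {J} (h : IsMetallicHVTensor α β nabla J) := h.eq_metallicField nabla
  refine ⟨⟨metallicField nabla α β, isMetallicHVTensor_metallicField nabla α β, fun J h ↦ hJ h⟩,
    fun J h ↦ ?_⟩
  rw [hJ h]
  exact isMetallicStructure_metallicField nabla α β
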